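/- Let $A,Q\in\mathbb{R}^{n_x\times n_x}$, $B\in\mathbb{R}^{n_x\times n_u}$, $R\in\mathbb{R}^{n_u\times n_u}$ and $S\in\mathbb{R}^{n_u\times n_x}$, where $\begin{bmatrix}Q&S^\top\\ S&R\end{bmatrix}$ is symmetric positive semidefinite. Consider the system $x_{t+1}=Ax_t+Bu_t+w_t$, $t\ge 0$, with a deterministic initial state $x_0$ and random disturbances $w_t\in\mathbb{R}^{n_x}$, where $\mathbb{E}w_t=0$ and $\mathbb{E}w_sw_t^\top$ equals $I$ if $s=t$ and $0$ otherwise. The cost of a controller is $$C=\lim_{T\to\infty}\frac1T\,\mathbb{E}\sum_{t=0}^{T-1}\left(x_t^\top Qx_t+u_t^\top Ru_t+2u_t^\top Sx_t\right).$$ Write $C(K)$ for the cost of the state feedback controller $u_t=Kx_t$, and $C(L_1,\dots,L_H)$ for the cost of the disturbance response controller (DRC) $u_t=L_1w_{t-1}+\cdots+L_Hw_{t-H}$, where $w_s=0$ for $s<0$. Let $\|\cdot\|$ be the matrix $\ell_2$ (operator) norm, and call a square matrix $X$ $(\tau,\gamma)$-stable if $\|X^k\|\le\tau\gamma^k$ for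 all $k\ge 0$. Let $\rho>0$ and suppose that $A$ is $(\tau,e^{-\rho})$-stable. Let $K\in\mathbb{R}^{n_u\times n_x}$ be such that $A+BK$ is $(\tau,e^{-\rho})$-stable, and put $L_{K;h}=K(A+BK)^{h-1}$ for $h\ge 1$. Then for every integer $H\ge 0$ the limits defining $C(L_{K;1},\dots,L_{K;H})$ and $C(K)$ exist and are finite, and $$C(L_{K;1},\dots,L_{K;H})-C(K)\le n_x^2e^{-2\rho H}\left(\|R\|+\frac{4\tau^4\left(\|B\|\|K\|^2+\|K\|\right)\left(\|B\|\|Q\|+\|S\|\right)}{(1-e^{-2\rho})^3}\right).$$ -/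

import Mathlib

open MeasureTheory Filter Topology
-- the norm of a matrix is its l2 operator norm
open scoped Matrix Matrix.Norms.L2Operator

noncomputable section

namespace LQR

/-- `X` is `(τ, γ)`-stable: `‖X ^ k‖ ≤ τ * γ ^ k` for all `k ≥ 0`. -/
def IsStable {n : ℕ} (X : Matrix (Fin n) (Fin n) ℝ) (τ γ : ℝ) : Prop :=
  ∀ k : ℕ, ‖X ^ k‖ ≤ τ * γ ^ k

/-- A square-integrable process with zero mean, identity covariance and no correlation in time
(for instance, an i.i.d. sequence of centred random vectors with identity covariance). -/
structure IsWhiteNoise {Ω : Type*} [MeasurableSpace Ω] (μ : Measure Ω) {n : ℕ}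
    (w : ℕ → Ω → (Fin n → ℝ)) : Prop where
  memLp : ∀ t i, MemLp (fun ω => w t ω i) 2 μ
  mean_zero : ∀ t i, ∫ ω, w t ω i ∂μ = 0
  covariance : ∀ s t i j, ∫ ω, w s ω i * w t ω j ∂μ = if s = t ∧ i = j then 1 else 0

/-- The state driven by an input sequence: `x_{t+1} = A x_t + B u_t + w_t`. -/
def state {n m : ℕ} (A : Matrix (Fin n) (Fin n) ℝ) (B : Matrix (Fin n) (Fin m) ℝ)
    (x₀ : Fin n → ℝ) (u : ℕ → (Fin m → ℝ)) (w : ℕ → (Fin n → ℝ)) : ℕ → (Fin n → ℝ)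
  | 0 => x₀
  | t + 1 => A *ᵥ state A B x₀ u w t + B *ᵥ u t + w t

/-- The state under the state feedback `u_t = K x_t`:
`x_{t+1} = A x_t + B (K x_t) + w_t`. -/
def feedbackState {n m : ℕ} (A : Matrix (Fin n) (Fin n) ℝ) (B : Matrix (Fin n) (Fin m) ℝ)
    (K : Matrix (Fin m) (Fin n) ℝ)
    (x₀ : Fin n → ℝ) (w : ℕ → (Fin n → ℝ)) : ℕ → (Fin n → ℝ)
  | 0 => x₀
  | t + 1 => A *ᵥ feedbackState A B K x₀ w t + B *ᵥ (K *ᵥ feedbackState A B K x₀ w t) + w t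

/-- The input of the disturbance response controller with gains `L 1, …, L H`:
`u_t = L_1 w_{t-1} + ⋯ + L_H w_{t-H}`, where `w_s = 0` for `s < 0`. -/
def drcInput {n m : ℕ} (H : ℕ) (L : ℕ → Matrix (Fin m) (Fin n) ℝ)
    (w : ℕ → (Fin n → ℝ)) (t : ℕ) : Fin m → ℝ :=
  ∑ h ∈ Finset.Icc 1 H, if h ≤ t then L h *ᵥ w (t - h) else 0

/-- The gains `L_{K;h} = K (A + B K)^(h-1)`, for `h ≥ 1`, of the disturbance response controller
equivalent to `K` (the value at `h = 0` is never used). -/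
def equivalentDRC {n m : ℕ} (A : Matrix (Fin n) (Fin n) ℝ) (B : Matrix (Fin n) (Fin m) ℝ)
    (K : Matrix (Fin m) (Fin n) ℝ) (h : ℕ) : Matrix (Fin m) (Fin n) ℝ :=
  K * (A + B * K) ^ (h - 1)

/-- `xᵀ Q x + uᵀ R u + 2 uᵀ S x`. -/
def stageCost {n m : ℕ} (Q : Matrix (Fin n) (Fin n) ℝ) (R : Matrix (Fin m) (Fin m) ℝ)
    (S : Matrix (Fin m) (Fin n) ℝ) (x : Fin n → ℝ) (u : Fin m → ℝ) : ℝ :=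
  x ⬝ᵥ (Q *ᵥ x) + u ⬝ᵥ (R *ᵥ u) + 2 * (u ⬝ᵥ (S *ᵥ x))

/-- The stage costs along the processes `x`, `u` are integrable, and the limit of
`(1 / T) 𝔼 ∑_{t < T} (x_tᵀ Q x_t + u_tᵀ R u_t + 2 u_tᵀ S x_t)` as `T → ∞` exists and is `c`. -/
def HasAverageCost {Ω : Type*} [MeasurableSpace Ω] (μ : Measure Ω) {n m : ℕ}
    (Q : Matrix (Fin n) (Fin n) ℝ) (R : Matrix (Fin m) (Fin m) ℝ) (S : Matrix (Fin m) (Fin n) ℝ)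
    (x : ℕ → Ω → (Fin n → ℝ)) (u : ℕ → Ω → (Fin m → ℝ)) (c : ℝ) : Prop :=
  (∀ t, Integrable (fun ω => stageCost Q R S (x t ω) (u t ω)) μ) ∧
  Tendsto (fun T : ℕ => (1 / (T : ℝ)) *
      ∫ ω, ∑ t ∈ Finset.range T, stageCost Q R S (x t ω) (u t ω) ∂μ) atTop (𝓝 c)

/-- `c` is the cost `C(K)` of the state feedback controller `u_t = K x_t`. -/
def HasFeedbackCost {Ω : Type*} [MeasurableSpace Ω] (μ : Measure Ω) {n m : ℕ}
    (A : Matrix (Fin n) (Fin n) ℝ) (B : Matrix (Fin n) (Fin m) ℝ)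
    (Q : Matrix (Fin n) (Fin n) ℝ) (R : Matrix (Fin m) (Fin m) ℝ) (S : Matrix (Fin m) (Fin n) ℝ)
    (x₀ : Fin n → ℝ) (w : ℕ → Ω → (Fin n → ℝ)) (K : Matrix (Fin m) (Fin n) ℝ) (c : ℝ) : Prop :=
  HasAverageCost μ Q R S
    (fun t ω => feedbackState A B K x₀ (fun s => w s ω) t)
    (fun t ω => K *ᵥ feedbackState A B K x₀ (fun s => w s ω) t) c

/-- `c` is the cost `C(L)` of the disturbance response controller of order `H` with gains
`L 1, …, L H`. -/
def HasDRCCost {Ω : Type*} [MeasurableSpace Ω] (μ : Measure Ω) {n m : ℕ}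
    (A : Matrix (Fin n) (Fin n) ℝ) (B : Matrix (Fin n) (Fin m) ℝ)
    (Q : Matrix (Fin n) (Fin n) ℝ) (R : Matrix (Fin m) (Fin m) ℝ) (S : Matrix (Fin m) (Fin n) ℝ)
    (x₀ : Fin n → ℝ) (w : ℕ → Ω → (Fin n → ℝ))
    (H : ℕ) (L : ℕ → Matrix (Fin m) (Fin n) ℝ) (c : ℝ) : Prop :=
  HasAverageCost μ Q R S
    (fun t ω => state A B x₀ (drcInput H L (fun s => w s ω)) (fun s => w s ω) t)
    (fun t ω => drcInput H L (fun s => w s ω) t) c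

end LQR

end

namespace LQR

/-! Both controllers make state and input affine in the past noise: x_t = a_t + Σ F_j w_{t-1-j} and
u_t = b_t + Σ G_j w_{t-1-j}, with a_t, b_t → 0. Whiteness turns the average cost into the sum over j
of `gainCost` at (F_j, G_j) (`IsWhiteNoise.hasAverageCost_response`).

The two gain sequences agree for j < H. From then on the DRC applies zero input, so its state gain
evolves from (A+BK)^H under A alone, and only the tails differ (`gainCost_tail_sub_le`). Let P solve
the Lyapunov equation for (A, Q). The DRC tail is V((A+BK)^H), where V(Z) = tr(ZᵀPZ). Telescoping V
along the closed loop Z_k = (A+BK)^(k+H) compares this with the feedback tail. Terms quadratic in K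
Z_k have the favourable sign and are dropped; the cross terms through S and PA are O(γ^(2(k+H))), γ
= e^(-ρ), and sum geometrically. The resulting bound is linear in n_x and free of ‖R‖;
`excess_bound_le` relaxes it to the stated one. -/

variable {Ω : Type*} [MeasurableSpace Ω] {μ : Measure Ω}

/-! ### Second moments of responses to white noise -/

/-- The second moments of affine combinations of centred orthonormal random variables. -/
lemma integral_affine_mul_affine [IsProbabilityMeasure μ] {ι : Type*} [DecidableEq ι]
    (s : Finset ι) {ξ : ι → Ω → ℝ} (hξ : ∀ p, MemLp (ξ p) 2 μ) (h0 : ∀ p, ∫ ω, ξ p ω ∂μ = 0)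
    (hcov : ∀ p q, ∫ ω, ξ p ω * ξ q ω ∂μ = if p = q then 1 else 0) (a b : ℝ) (c d : ι → ℝ) :
    Integrable (fun ω => (a + ∑ p ∈ s, c p * ξ p ω) * (b + ∑ p ∈ s, d p * ξ p ω)) μ ∧
      ∫ ω, (a + ∑ p ∈ s, c p * ξ p ω) * (b + ∑ p ∈ s, d p * ξ p ω) ∂μ
        = a * b + ∑ p ∈ s, c p * d p := by
  have hlin : ∀ e : ι → ℝ, MemLp (fun ω => ∑ p ∈ s, e p * ξ p ω) 2 μ := fun e =>
    memLp_finsetSum s fun p _ => (hξ p).const_mul (e p)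
  have hlin1 : ∀ e : ι → ℝ, Integrable (fun ω => ∑ p ∈ s, e p * ξ p ω) μ := fun e =>
    (hlin e).integrable (by norm_num)
  have hmean : ∀ e : ι → ℝ, ∫ ω, ∑ p ∈ s, e p * ξ p ω ∂μ = 0 := fun e => by
    rw [integral_finsetSum _ fun p _ => ((hξ p).integrable (by norm_num)).const_mul _]
    simp [integral_const_mul, h0]
  have hmul : Integrable (fun ω => (∑ p ∈ s, c p * ξ p ω) * ∑ p ∈ s, d p * ξ p ω) μ :=
    (hlin c).integrable_mul (hlin d)
  have hprod : ∫ ω, (∑ p ∈ s, c p * ξ p ω) * (∑ p ∈ s, d p * ξ p ω) ∂μ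
      = ∑ p ∈ s, c p * d p := by
    have hint : ∀ p q, Integrable (fun ω => c p * d q * (ξ p ω * ξ q ω)) μ := fun p q =>
      ((hξ p).integrable_mul (hξ q)).const_mul _
    have heq : ∀ ω, (∑ p ∈ s, c p * ξ p ω) * (∑ p ∈ s, d p * ξ p ω)
        = ∑ p ∈ s, ∑ q ∈ s, c p * d q * (ξ p ω * ξ q ω) := fun ω => by
      rw [Finset.sum_mul_sum]
      exact Finset.sum_congr rfl fun p _ => Finset.sum_congr rfl fun q _ => by ring
    simp_rw [heq]
    rw [integral_finsetSum _ fun p _ => integrable_finsetSum _ fun q _ => hint p q]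
    refine Finset.sum_congr rfl fun p hp => ?_
    rw [integral_finsetSum _ fun q _ => hint p q]
    simp [integral_const_mul, hcov, hp]
  have heq : ∀ ω, (a + ∑ p ∈ s, c p * ξ p ω) * (b + ∑ p ∈ s, d p * ξ p ω)
      = a * b + a * (∑ p ∈ s, d p * ξ p ω) + b * (∑ p ∈ s, c p * ξ p ω)
        + (∑ p ∈ s, c p * ξ p ω) * (∑ p ∈ s, d p * ξ p ω) := fun ω => by ring
  simp_rw [heq]
  have i1 := (hlin1 d).const_mul a
  have i2 := (hlin1 c).const_mul b
  have i0 : Integrable (fun _ : Ω => a * b) μ := integrable_const _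
  have i01 : Integrable (fun ω => a * b + a * ∑ p ∈ s, d p * ξ p ω) μ := i0.add i1
  have i012 : Integrable (fun ω => a * b + a * (∑ p ∈ s, d p * ξ p ω)
      + b * ∑ p ∈ s, c p * ξ p ω) μ := i01.add i2
  refine ⟨i012.add hmul, ?_⟩
  rw [integral_add i012 hmul, integral_add i01 i2, integral_add i0 i1, hprod]
  simp [integral_const_mul, hmean]

/-- The affine response `a + F_0 w_{t-1} + ⋯ + F_{t-1} w_0` to the disturbances. -/
def response {n k : ℕ} (a : Fin k → ℝ) (F : ℕ → Matrix (Fin k) (Fin n) ℝ)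
    (w : ℕ → (Fin n → ℝ)) (t : ℕ) : Fin k → ℝ :=
  a + ∑ s ∈ Finset.range t, F (t - 1 - s) *ᵥ w s

lemma response_apply {n k : ℕ} (a : Fin k → ℝ) (F : ℕ → Matrix (Fin k) (Fin n) ℝ)
    (w : ℕ → (Fin n → ℝ)) (t : ℕ) (i : Fin k) :
    response a F w t i
      = a i + ∑ p ∈ Finset.range t ×ˢ Finset.univ, F (t - 1 - p.1) i p.2 * w p.1 p.2 := by
  simp [response, Finset.sum_product, Matrix.mulVec, dotProduct]

lemma dotProduct_mulVec_eq_sum {k l : ℕ} (N : Matrix (Fin k) (Fin l) ℝ) (x : Fin k → ℝ)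
    (y : Fin l → ℝ) : x ⬝ᵥ (N *ᵥ y) = ∑ i, ∑ j, N i j * (x i * y j) := by
  simp only [dotProduct, Matrix.mulVec, Finset.mul_sum]
  exact Finset.sum_congr rfl fun i _ => Finset.sum_congr rfl fun j _ => by ring

lemma trace_transpose_mul_mul {k l n : ℕ} (N : Matrix (Fin k) (Fin l) ℝ)
    (F : Matrix (Fin k) (Fin n) ℝ) (G : Matrix (Fin l) (Fin n) ℝ) :
    (Fᵀ * N * G).trace = ∑ i, ∑ j, N i j * ∑ e, F i e * G j e := by
  simp only [Matrix.trace, Matrix.diag_apply, Matrix.mul_apply, Matrix.transpose_apply,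
    Finset.mul_sum, Finset.sum_mul]
  rw [Finset.sum_comm]
  simp_rw [Finset.sum_comm (s := (Finset.univ : Finset (Fin n)))]
  rw [Finset.sum_comm]
  exact Finset.sum_congr rfl fun i _ => Finset.sum_congr rfl fun j _ =>
    Finset.sum_congr rfl fun e _ => by ring

lemma IsWhiteNoise.integral_dotProduct_response [IsProbabilityMeasure μ] {n k l : ℕ}
    {w : ℕ → Ω → (Fin n → ℝ)} (hw : IsWhiteNoise μ w) (N : Matrix (Fin k) (Fin l) ℝ)
    (a : Fin k → ℝ) (b : Fin l → ℝ) (F : ℕ → Matrix (Fin k) (Fin n) ℝ)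
    (G : ℕ → Matrix (Fin l) (Fin n) ℝ) (t : ℕ) :
    Integrable (fun ω => response a F (fun s => w s ω) t ⬝ᵥ
        (N *ᵥ response b G (fun s => w s ω) t)) μ ∧
      ∫ ω, response a F (fun s => w s ω) t ⬝ᵥ (N *ᵥ response b G (fun s => w s ω) t) ∂μ
        = a ⬝ᵥ (N *ᵥ b) + ∑ j ∈ Finset.range t, ((F j)ᵀ * N * G j).trace := by
  have key := fun (i : Fin k) (j : Fin l) =>
    integral_affine_mul_affine (μ := μ) (Finset.range t ×ˢ Finset.univ)
      (ξ := fun (p : ℕ × Fin n) ω => w p.1 ω p.2) (fun p => hw.memLp p.1 p.2)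
      (fun p => hw.mean_zero p.1 p.2)
      (fun p q => by simp [hw.covariance, Prod.ext_iff]) (a i) (b j)
      (fun p => F (t - 1 - p.1) i p.2) (fun p => G (t - 1 - p.1) j p.2)
  have key' := fun i j => (key i j).1.const_mul (N i j)
  simp_rw [dotProduct_mulVec_eq_sum N, response_apply]
  refine ⟨integrable_finsetSum _ fun i _ => integrable_finsetSum _ fun j _ => key' i j, ?_⟩
  rw [integral_finsetSum _ fun i _ => integrable_finsetSum _ fun j _ => key' i j]
  simp_rw [integral_finsetSum _ fun j _ => key' _ j, integral_const_mul, (key _ _).2,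
    Finset.sum_product, trace_transpose_mul_mul]
  rw [Finset.sum_comm (s := Finset.range t), ← Finset.sum_add_distrib]
  refine Finset.sum_congr rfl fun i _ => ?_
  rw [Finset.sum_comm (s := Finset.range t), ← Finset.sum_add_distrib]
  refine Finset.sum_congr rfl fun j _ => ?_
  -- Time reversal s ↦ t - 1 - s turns noise times into lags.
  rw [mul_add, ← Finset.mul_sum,
    Finset.sum_range_reflect (fun r => ∑ e, F r i e * G r j e)]

/-! ### Average cost as a sum over gains -/

/-- The stationary cost contributed by a disturbance whose effects on state and input are
given by the gains `F` and `G`. -/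
def gainCost {n m : ℕ} (Q : Matrix (Fin n) (Fin n) ℝ) (R : Matrix (Fin m) (Fin m) ℝ)
    (S : Matrix (Fin m) (Fin n) ℝ) (F : Matrix (Fin n) (Fin n) ℝ)
    (G : Matrix (Fin m) (Fin n) ℝ) : ℝ :=
  (Fᵀ * Q * F).trace + (Gᵀ * R * G).trace + 2 * (Gᵀ * S * F).trace

/-- The expected stage cost at time t is the cost of the offsets, which vanishes, plus the t-th
partial sum of the series; it tends to c, hence so do its Cesàro means. -/
lemma IsWhiteNoise.hasAverageCost_response [IsProbabilityMeasure μ] {n m : ℕ}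
    {w : ℕ → Ω → (Fin n → ℝ)} (hw : IsWhiteNoise μ w) (Q : Matrix (Fin n) (Fin n) ℝ)
    (R : Matrix (Fin m) (Fin m) ℝ) (S : Matrix (Fin m) (Fin n) ℝ)
    {a : ℕ → Fin n → ℝ} {b : ℕ → Fin m → ℝ} {F : ℕ → Matrix (Fin n) (Fin n) ℝ}
    {G : ℕ → Matrix (Fin m) (Fin n) ℝ} (ha : Tendsto a atTop (𝓝 0)) (hb : Tendsto b atTop (𝓝 0))
    {c : ℝ} (hc : HasSum (fun j => gainCost Q R S (F j) (G j)) c) :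
    HasAverageCost μ Q R S (fun t ω => response (a t) F (fun s => w s ω) t)
      (fun t ω => response (b t) G (fun s => w s ω) t) c := by
  have hQ := fun t => hw.integral_dotProduct_response Q (a t) (a t) F F t
  have hR := fun t => hw.integral_dotProduct_response R (b t) (b t) G G t
  have hS := fun t => hw.integral_dotProduct_response S (b t) (a t) G F t
  have hint : ∀ t, Integrable (fun ω => stageCost Q R S (response (a t) F (fun s => w s ω) t)
      (response (b t) G (fun s => w s ω) t)) μ := fun t =>
    ((hQ t).1.add (hR t).1).add ((hS t).1.const_mul 2)
  refine ⟨hint, ?_⟩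
  have hval : ∀ t, ∫ ω, stageCost Q R S (response (a t) F (fun s => w s ω) t)
      (response (b t) G (fun s => w s ω) t) ∂μ
      = stageCost Q R S (a t) (b t)
        + ∑ j ∈ Finset.range t, gainCost Q R S (F j) (G j) := fun t => by
    unfold stageCost gainCost
    have hQR : Integrable (fun ω =>
        response (a t) F (fun s => w s ω) t ⬝ᵥ (Q *ᵥ response (a t) F (fun s => w s ω) t)
        + response (b t) G (fun s => w s ω) t ⬝ᵥ (R *ᵥ response (b t) G (fun s => w s ω) t)) μ :=
      (hQ t).1.add (hR t).1
    rw [integral_add hQR ((hS t).1.const_mul 2),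
      integral_add (hQ t).1 (hR t).1, integral_const_mul, (hQ t).2, (hR t).2, (hS t).2,
      Finset.sum_add_distrib, Finset.sum_add_distrib, ← Finset.mul_sum]
    ring
  have hstage : Tendsto (fun t => stageCost Q R S (a t) (b t)) atTop (𝓝 0) := by
    have hcont : Continuous fun p : (Fin n → ℝ) × (Fin m → ℝ) => stageCost Q R S p.1 p.2 := by
      unfold stageCost; fun_prop
    have := (hcont.tendsto (0, 0)).comp (ha.prodMk_nhds hb)
    simpa [stageCost, Function.comp_def] using this
  have hlim := (hstage.add hc.tendsto_sum_nat).cesaro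
  rw [zero_add] at hlim
  refine hlim.congr fun T => ?_
  rw [integral_finsetSum _ fun t _ => hint t]
  simp_rw [hval, one_div]

/-! ### Controllers as responses -/

/-- F and G are impulse responses: w_t enters x_{t+1} with weight F 0 = 1, and each later step
applies the system recursion. -/
lemma state_eq_response {n m : ℕ} (A : Matrix (Fin n) (Fin n) ℝ) (B : Matrix (Fin n) (Fin m) ℝ)
    (x₀ : Fin n → ℝ) (w : ℕ → (Fin n → ℝ)) {F : ℕ → Matrix (Fin n) (Fin n) ℝ}
    {G : ℕ → Matrix (Fin m) (Fin n) ℝ} (hF0 : F 0 = 1)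
    (hF : ∀ j, F (j + 1) = A * F j + B * G j) (t : ℕ) :
    state A B x₀ (response 0 G w) w t = response (A ^ t *ᵥ x₀) F w t := by
  induction t with
  | zero => simp [state, response]
  | succ t ih =>
    rw [state, ih]
    simp only [response, zero_add, Finset.sum_range_succ, Nat.add_sub_cancel, Nat.sub_self, hF0,
      Matrix.one_mulVec, Matrix.mulVec_add, Matrix.mulVec_mulVec, Matrix.mulVec_sum, ← pow_succ']
    rw [add_assoc (A ^ (t + 1) *ᵥ x₀), ← Finset.sum_add_distrib, ← add_assoc]
    congr 2
    refine Finset.sum_congr rfl fun s hs => ?_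
    have : t - s = t - 1 - s + 1 := by have := Finset.mem_range.1 hs; omega
    rw [this, hF, Matrix.add_mulVec]

lemma feedbackState_eq_response {n m : ℕ} (A : Matrix (Fin n) (Fin n) ℝ)
    (B : Matrix (Fin n) (Fin m) ℝ) (K : Matrix (Fin m) (Fin n) ℝ)
    (x₀ : Fin n → ℝ) (w : ℕ → (Fin n → ℝ)) (t : ℕ) :
    feedbackState A B K x₀ w t
      = response ((A + B * K) ^ t *ᵥ x₀) (fun j => (A + B * K) ^ j) w t := by
  -- The closed loop is the system with matrix A + BK and zero input.
  rw [← state_eq_response (A + B * K) B x₀ w (G := fun _ => 0) (by simp)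
    (fun j => by simp [pow_succ'])]
  induction t with
  | zero => rfl
  | succ t ih =>
    rw [feedbackState, state, ih]
    simp [response, Matrix.add_mulVec, Matrix.mulVec_mulVec]

lemma mulVec_response {n k l : ℕ} (N : Matrix (Fin l) (Fin k) ℝ) (a : Fin k → ℝ)
    (F : ℕ → Matrix (Fin k) (Fin n) ℝ) (w : ℕ → (Fin n → ℝ)) (t : ℕ) :
    N *ᵥ response a F w t = response (N *ᵥ a) (fun j => N * F j) w t := by
  simp [response, Matrix.mulVec_add, Matrix.mulVec_sum, Matrix.mulVec_mulVec]

lemma drcInput_eq_response {n m : ℕ} (H : ℕ) (L : ℕ → Matrix (Fin m) (Fin n) ℝ)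
    (w : ℕ → (Fin n → ℝ)) :
    drcInput H L w = response 0 (fun j => if j < H then L (j + 1) else 0) w := by
  funext t
  simp only [drcInput, response, zero_add]
  have hL : ∑ h ∈ Finset.Icc 1 H, (if h ≤ t then L h *ᵥ w (t - h) else 0)
      = ∑ j ∈ Finset.range H, if j < t then L (j + 1) *ᵥ w (t - (j + 1)) else 0 := by
    rw [Finset.range_eq_Ico]
    refine Eq.trans ?_
      (Finset.sum_Ico_add' (fun h => if h ≤ t then L h *ᵥ w (t - h) else 0) 0 H 1).symm
    exact Finset.sum_congr (by ext; simp) fun _ _ => rfl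
  have hR : ∑ s ∈ Finset.range t, (if t - 1 - s < H then L (t - 1 - s + 1) else 0) *ᵥ w s
      = ∑ j ∈ Finset.range t, if j < H then L (j + 1) *ᵥ w (t - (j + 1)) else 0 := by
    rw [← Finset.sum_range_reflect]
    refine Finset.sum_congr rfl fun j hj => ?_
    have hj := Finset.mem_range.1 hj
    rw [show t - 1 - (t - 1 - j) = j by omega, show t - 1 - j = t - (j + 1) by omega]
    split_ifs <;> simp
  -- With lag j = h - 1, both sums run over j < min H t.
  rw [hL, hR, ← Finset.sum_filter, ← Finset.sum_filter]
  exact Finset.sum_congr (by ext; simp [and_comm]) fun _ _ => rfl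

/-! ### Trace and norm estimates -/

lemma norm_transpose {k l : ℕ} (X : Matrix (Fin k) (Fin l) ℝ) : ‖Xᵀ‖ = ‖X‖ := by
  rw [← Matrix.conjTranspose_eq_transpose_of_trivial, Matrix.l2_opNorm_conjTranspose]

/-- Each diagonal entry is at most the operator norm; this is where the dimension factor enters. -/
lemma abs_trace_le {n : ℕ} (X : Matrix (Fin n) (Fin n) ℝ) : |X.trace| ≤ n * ‖X‖ := by
  have hentry : ∀ i, |X i i| ≤ ‖X‖ := fun i => by
    have h1 := X.l2_opNorm_mulVec (EuclideanSpace.single i 1)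
    have h2 := PiLp.norm_apply_le (WithLp.toLp 2 (X *ᵥ (EuclideanSpace.single i (1 : ℝ)).ofLp)) i
    simpa using h2.trans h1
  calc |X.trace| ≤ ∑ i, |X i i| := Finset.abs_sum_le_sum_abs _ _
    _ ≤ ∑ _i : Fin n, ‖X‖ := Finset.sum_le_sum fun i _ => hentry i
    _ = n * ‖X‖ := by simp

lemma abs_trace_transpose_mul_mul_le {k l n : ℕ} (N : Matrix (Fin k) (Fin l) ℝ)
    (F : Matrix (Fin k) (Fin n) ℝ) (G : Matrix (Fin l) (Fin n) ℝ) :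
    |(Fᵀ * N * G).trace| ≤ n * (‖F‖ * ‖N‖ * ‖G‖) := by
  refine (abs_trace_le _).trans (mul_le_mul_of_nonneg_left ?_ (Nat.cast_nonneg _))
  refine (Matrix.l2_opNorm_mul _ _).trans (mul_le_mul_of_nonneg_right ?_ (norm_nonneg _))
  exact (Matrix.l2_opNorm_mul _ _).trans_eq (by rw [norm_transpose])

lemma IsStable.nonneg {n : ℕ} {X : Matrix (Fin n) (Fin n) ℝ} {τ γ : ℝ} (hX : IsStable X τ γ) :
    0 ≤ τ := by
  simpa using (norm_nonneg _).trans (hX 0)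

lemma summable_trace_transpose_mul_mul {k l n : ℕ} (N : Matrix (Fin k) (Fin l) ℝ)
    {F : ℕ → Matrix (Fin k) (Fin n) ℝ} {G : ℕ → Matrix (Fin l) (Fin n) ℝ} {a b γ : ℝ}
    (hγ0 : 0 ≤ γ) (hγ1 : γ < 1) (hF : ∀ j, ‖F j‖ ≤ a * γ ^ j) (hG : ∀ j, ‖G j‖ ≤ b * γ ^ j) :
    Summable fun j => ((F j)ᵀ * N * G j).trace := by
  have hγ2 : γ ^ 2 < 1 := by nlinarith
  refine Summable.of_norm_bounded (g := fun j => n * (a * ‖N‖ * b) * (γ ^ 2) ^ j)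
    ((summable_geometric_of_lt_one (sq_nonneg γ) hγ2).mul_left _) fun j => ?_
  refine (abs_trace_transpose_mul_mul_le N (F j) (G j)).trans ?_
  calc (n : ℝ) * (‖F j‖ * ‖N‖ * ‖G j‖) ≤ n * (a * γ ^ j * ‖N‖ * (b * γ ^ j)) := by
        have := (norm_nonneg _).trans (hF j)
        gcongr
        exacts [hF j, hG j]
    _ = _ := by ring

lemma summable_gainCost {n m : ℕ} (Q : Matrix (Fin n) (Fin n) ℝ) (R : Matrix (Fin m) (Fin m) ℝ)
    (S : Matrix (Fin m) (Fin n) ℝ) {F : ℕ → Matrix (Fin n) (Fin n) ℝ}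
    {G : ℕ → Matrix (Fin m) (Fin n) ℝ} {a b γ : ℝ}
    (hγ0 : 0 ≤ γ) (hγ1 : γ < 1) (hF : ∀ j, ‖F j‖ ≤ a * γ ^ j) (hG : ∀ j, ‖G j‖ ≤ b * γ ^ j) :
    Summable fun j => gainCost Q R S (F j) (G j) :=
  ((summable_trace_transpose_mul_mul Q hγ0 hγ1 hF hF).add
    (summable_trace_transpose_mul_mul R hγ0 hγ1 hG hG)).add
    ((summable_trace_transpose_mul_mul S hγ0 hγ1 hG hF).mul_left 2)

/-! ### Lyapunov equation and excess cost of the tail -/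

/-- The solution `P = ∑ₖ (Aᵏ)ᵀ Q Aᵏ` of the Lyapunov equation `P = Q + Aᵀ P A`. -/
lemma IsStable.exists_lyapunov {n : ℕ} {A : Matrix (Fin n) (Fin n) ℝ} {τ γ : ℝ} (hγ0 : 0 ≤ γ)
    (hγ1 : γ < 1) (hA : IsStable A τ γ) {Q : Matrix (Fin n) (Fin n) ℝ} (hQ : Qᵀ = Q) :
    ∃ P : Matrix (Fin n) (Fin n) ℝ, Pᵀ = P ∧ P = Q + Aᵀ * P * A ∧
      ‖P * A‖ ≤ τ ^ 2 * γ * ‖Q‖ / (1 - γ ^ 2) ∧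
      ∀ Y : Matrix (Fin n) (Fin n) ℝ,
        HasSum (fun k => ((A ^ k * Y)ᵀ * Q * (A ^ k * Y)).trace) (Yᵀ * P * Y).trace := by
  have hγ2 : γ ^ 2 < 1 := by nlinarith
  have hτ := hA.nonneg
  have hterm : ∀ k l, ‖(A ^ k)ᵀ * Q * A ^ l‖ ≤ τ * γ ^ k * ‖Q‖ * (τ * γ ^ l) := fun k l =>
    calc ‖(A ^ k)ᵀ * Q * A ^ l‖ ≤ ‖(A ^ k)ᵀ‖ * ‖Q‖ * ‖A ^ l‖ :=
          (norm_mul_le _ _).trans (mul_le_mul_of_nonneg_right (norm_mul_le _ _) (norm_nonneg _))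
      _ ≤ τ * γ ^ k * ‖Q‖ * (τ * γ ^ l) := by
          rw [norm_transpose]; gcongr; exacts [hA k, hA l]
  have hgeo := hasSum_geometric_of_lt_one (sq_nonneg γ) hγ2
  have hsum : Summable fun k => (A ^ k)ᵀ * Q * A ^ k := by
    refine Summable.of_norm_bounded (g := fun k => τ ^ 2 * ‖Q‖ * (γ ^ 2) ^ k)
      (hgeo.summable.mul_left _) fun k => (hterm k k).trans_eq (by ring)
  obtain ⟨P, hP⟩ := hsum
  refine ⟨P, ?_, ?_, ?_, fun Y => ?_⟩
  · refine hP.matrix_transpose.unique ?_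
    simpa [Matrix.transpose_mul, hQ, Matrix.mul_assoc] using hP
  · have h1 : HasSum (fun k => (A ^ (k + 1))ᵀ * Q * A ^ (k + 1)) (Aᵀ * P * A) := by
      simpa only [pow_succ, Matrix.transpose_mul, Matrix.mul_assoc]
        using (hP.mul_left Aᵀ).mul_right A
    have h2 := ((hasSum_nat_add_iff' 1).2 hP).unique h1
    rw [← h2]
    simp
  -- Bounding the series of PA termwise, rather than ‖P‖ ‖A‖, avoids an extra factor τ.
  · have h1 := hP.mul_right A
    rw [← h1.tsum_eq]
    refine tsum_of_norm_bounded (g := fun k => τ ^ 2 * γ * ‖Q‖ * (γ ^ 2) ^ k)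
      (by simpa [div_eq_mul_inv] using hgeo.mul_left (τ ^ 2 * γ * ‖Q‖)) fun k => ?_
    rw [Matrix.mul_assoc, ← pow_succ]
    exact (hterm k (k + 1)).trans_eq (by ring)
  · have h1 := ((hP.mul_left Yᵀ).mul_right Y).map (Matrix.traceAddMonoidHom (Fin n) ℝ)
      (continuous_id.matrix_trace)
    simpa only [Function.comp_def, Matrix.traceAddMonoidHom_apply, Matrix.transpose_mul,
      Matrix.mul_assoc] using h1

lemma trace_transpose_add_mul_add {k n : ℕ} {P : Matrix (Fin k) (Fin k) ℝ} (hP : Pᵀ = P)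
    (X Y : Matrix (Fin k) (Fin n) ℝ) :
    ((X + Y)ᵀ * P * (X + Y)).trace
      = (Xᵀ * P * X).trace + 2 * (Yᵀ * P * X).trace + (Yᵀ * P * Y).trace := by
  have h : (Xᵀ * P * Y).trace = (Yᵀ * P * X).trace := by
    rw [← Matrix.trace_transpose]
    simp [Matrix.transpose_mul, hP, Matrix.mul_assoc]
  simp only [Matrix.transpose_add, Matrix.add_mul, Matrix.mul_add, Matrix.trace_add, h]
  ring

/-- The excess cost of switching from the feedback gain `K` to zero input after `H` steps. -/
lemma gainCost_tail_sub_le {n m : ℕ} {A : Matrix (Fin n) (Fin n) ℝ} {B : Matrix (Fin n) (Fin m) ℝ}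
    {Q : Matrix (Fin n) (Fin n) ℝ} {R : Matrix (Fin m) (Fin m) ℝ} {S : Matrix (Fin m) (Fin n) ℝ}
    {K : Matrix (Fin m) (Fin n) ℝ} {τ γ : ℝ} (hγ0 : 0 ≤ γ) (hγ1 : γ < 1) (hA : IsStable A τ γ)
    (hK : IsStable (A + B * K) τ γ) (hQ : Qᵀ = Q)
    (hQ0 : ∀ Y : Matrix (Fin n) (Fin n) ℝ, 0 ≤ (Yᵀ * Q * Y).trace)
    (hR0 : ∀ Y : Matrix (Fin m) (Fin n) ℝ, 0 ≤ (Yᵀ * R * Y).trace) (H : ℕ) {c₁ c₂ : ℝ}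
    (h₁ : HasSum (fun k => gainCost Q R S (A ^ k * (A + B * K) ^ H) 0) c₁)
    (h₂ : HasSum (fun k => gainCost Q R S ((A + B * K) ^ (k + H)) (K * (A + B * K) ^ (k + H))) c₂) :
    c₁ - c₂ ≤ n * (γ ^ 2) ^ H * (2 * τ ^ 2 * ‖K‖ *
      (‖S‖ + ‖B‖ * (τ ^ 2 * γ * ‖Q‖ / (1 - γ ^ 2)))) / (1 - γ ^ 2) := by
  have hγ2 : γ ^ 2 < 1 := by nlinarith
  have hτ := hA.nonneg
  obtain ⟨P, hPt, hPeq, hPA, hPsum⟩ := hA.exists_lyapunov hγ0 hγ1 hQ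
  set p := τ ^ 2 * γ * ‖Q‖ / (1 - γ ^ 2)
  have hp : 0 ≤ p := (norm_nonneg _).trans hPA
  have hP0 : ∀ Y : Matrix (Fin n) (Fin n) ℝ, 0 ≤ (Yᵀ * P * Y).trace := fun Y =>
    (hPsum Y).nonneg fun k => hQ0 _
  set Z : ℕ → Matrix (Fin n) (Fin n) ℝ := fun k => (A + B * K) ^ (k + H) with hZ
  set v : ℕ → ℝ := fun k => ((Z k)ᵀ * P * Z k).trace with hv
  have hc₁ : c₁ = v 0 := by
    refine h₁.unique ?_
    simpa [gainCost, hv, hZ] using hPsum ((A + B * K) ^ H)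
  set E := n * (γ ^ 2) ^ H * (2 * τ ^ 2 * ‖K‖ * (‖S‖ + ‖B‖ * p)) with hE
  have hZnorm : ∀ k, ‖Z k‖ ≤ τ * γ ^ (k + H) := fun k => hK _
  -- Expand v at Z (k+1) = A Z k + B K Z k and use P = Q + AᵀPA: the Q terms cancel, the R term and
  -- the P term in B K Z k are nonnegative, and the two cross terms cost at most E γ^(2k).
  have hstep : ∀ k, -gainCost Q R S (Z k) (K * Z k) ≤ v (k + 1) - v k + E * (γ ^ 2) ^ k := by
    intro k
    have hZs : Z (k + 1) = A * Z k + B * (K * Z k) := by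
      simp only [hZ]
      rw [show k + 1 + H = k + H + 1 by ring, pow_succ', Matrix.add_mul, Matrix.mul_assoc]
    have hv1 : v (k + 1) = ((A * Z k)ᵀ * P * (A * Z k)).trace
        + 2 * ((B * (K * Z k))ᵀ * (P * A) * Z k).trace
        + ((B * (K * Z k))ᵀ * P * (B * (K * Z k))).trace := by
      simp only [hv]
      rw [hZs, trace_transpose_add_mul_add hPt]
      simp only [Matrix.mul_assoc]
    have hv0 : v k = ((Z k)ᵀ * Q * Z k).trace + ((A * Z k)ᵀ * P * (A * Z k)).trace := by
      simp only [hv]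
      conv_lhs => rw [hPeq]
      simp only [Matrix.mul_add, Matrix.add_mul, Matrix.trace_add, Matrix.transpose_mul,
        Matrix.mul_assoc]
    have hKZ : ‖K * Z k‖ ≤ ‖K‖ * (τ * γ ^ (k + H)) :=
      (Matrix.l2_opNorm_mul _ _).trans (mul_le_mul_of_nonneg_left (hZnorm k) (norm_nonneg _))
    have hBKZ : ‖B * (K * Z k)‖ ≤ ‖B‖ * (‖K‖ * (τ * γ ^ (k + H))) :=
      (Matrix.l2_opNorm_mul _ _).trans (mul_le_mul_of_nonneg_left hKZ (norm_nonneg _))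
    have e1 : |((K * Z k)ᵀ * S * Z k).trace|
        ≤ n * (‖K‖ * (τ * γ ^ (k + H)) * ‖S‖ * (τ * γ ^ (k + H))) := by
      refine (abs_trace_transpose_mul_mul_le _ _ _).trans ?_
      gcongr
      exact hZnorm k
    have e2 : |((B * (K * Z k))ᵀ * (P * A) * Z k).trace|
        ≤ n * (‖B‖ * (‖K‖ * (τ * γ ^ (k + H))) * p * (τ * γ ^ (k + H))) := by
      refine (abs_trace_transpose_mul_mul_le _ _ _).trans ?_
      gcongr
      exact hZnorm k
    have hEk : E * (γ ^ 2) ^ k = 2 * (n * (‖K‖ * (τ * γ ^ (k + H)) * ‖S‖ * (τ * γ ^ (k + H))))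
        + 2 * (n * (‖B‖ * (‖K‖ * (τ * γ ^ (k + H))) * p * (τ * γ ^ (k + H)))) := by
      rw [hE]; ring
    have h3 := hP0 (B * (K * Z k))
    have h4 := hR0 (K * Z k)
    have h5 := neg_abs_le ((K * Z k)ᵀ * S * Z k).trace
    have h6 := neg_abs_le ((B * (K * Z k))ᵀ * (P * A) * Z k).trace
    rw [hv1, hv0, hEk, gainCost]
    linarith
  have hpartial : ∀ N, ∑ k ∈ Finset.range N, -gainCost Q R S (Z k) (K * Z k)
      ≤ v N - v 0 + ∑ k ∈ Finset.range N, E * (γ ^ 2) ^ k := fun N => by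
    rw [← Finset.sum_range_sub, ← Finset.sum_add_distrib]
    exact Finset.sum_le_sum fun k _ => hstep k
  have hv_lim : Tendsto v atTop (𝓝 0) := by
    refine (summable_trace_transpose_mul_mul P hγ0 hγ1 (a := τ * γ ^ H) (b := τ * γ ^ H)
      (F := Z) (G := Z) ?_ ?_).tendsto_atTop_zero <;>
    exact fun k => (hZnorm k).trans_eq (by ring)
  -- As v N → 0, the limit reads -c₂ ≤ -v 0 + E / (1 - γ²), with v 0 = c₁.
  have hlim := le_of_tendsto_of_tendsto' h₂.neg.tendsto_sum_nat
    ((hv_lim.sub_const (v 0)).add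
      ((hasSum_geometric_of_lt_one (sq_nonneg γ) hγ2).mul_left E).tendsto_sum_nat) hpartial
  rw [hc₁, div_eq_mul_inv]
  linarith

lemma trace_nonneg_of_posSemidef_fromBlocks {n m k : ℕ} {Q : Matrix (Fin n) (Fin n) ℝ}
    {R : Matrix (Fin m) (Fin m) ℝ} {S : Matrix (Fin m) (Fin n) ℝ}
    (h : (Matrix.fromBlocks Q Sᵀ S R).PosSemidef) :
    Qᵀ = Q ∧ (∀ Y : Matrix (Fin n) (Fin k) ℝ, 0 ≤ (Yᵀ * Q * Y).trace) ∧
      ∀ Y : Matrix (Fin m) (Fin k) ℝ, 0 ≤ (Yᵀ * R * Y).trace := by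
  have hQ : Q.PosSemidef := h.submatrix Sum.inl
  have hR : R.PosSemidef := h.submatrix Sum.inr
  refine ⟨by simpa using hQ.isHermitian.eq, fun Y => ?_, fun Y => ?_⟩
  · simpa using (hQ.conjTranspose_mul_mul_same Y).trace_nonneg
  · simpa using (hR.conjTranspose_mul_mul_same Y).trace_nonneg

lemma IsStable.tendsto_pow_mulVec {n : ℕ} {X : Matrix (Fin n) (Fin n) ℝ} {τ γ : ℝ} (hγ0 : 0 ≤ γ)
    (hγ1 : γ < 1) (hX : IsStable X τ γ) (x : Fin n → ℝ) :
    Tendsto (fun t => X ^ t *ᵥ x) atTop (𝓝 0) := by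
  have hpow : Tendsto (fun t => X ^ t) atTop (𝓝 0) := by
    refine squeeze_zero_norm hX ?_
    simpa using (tendsto_pow_atTop_nhds_zero_of_lt_one hγ0 hγ1).const_mul τ
  have hcont : Continuous fun Y : Matrix (Fin n) (Fin n) ℝ => Y *ᵥ x := by fun_prop
  simpa [Function.comp_def] using (hcont.tendsto 0).comp hpow

/-! ### Truncated gains and the final bound -/

/-- The state gains of the order-`H` disturbance response controller equivalent to `K`. -/
def truncatedGain {n m : ℕ} (A : Matrix (Fin n) (Fin n) ℝ) (B : Matrix (Fin n) (Fin m) ℝ)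
    (K : Matrix (Fin m) (Fin n) ℝ) (H j : ℕ) : Matrix (Fin n) (Fin n) ℝ :=
  A ^ (j - H) * (A + B * K) ^ min j H

/-- For j < H the two summands combine into (A+BK)^(j+1); for j ≥ H the input gain is zero and only
A acts. -/
lemma truncatedGain_succ {n m : ℕ} (A : Matrix (Fin n) (Fin n) ℝ) (B : Matrix (Fin n) (Fin m) ℝ)
    (K : Matrix (Fin m) (Fin n) ℝ) (H j : ℕ) :
    truncatedGain A B K H (j + 1) = A * truncatedGain A B K H j
      + B * (if j < H then equivalentDRC A B K (j + 1) else 0) := by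
  unfold truncatedGain equivalentDRC
  split_ifs with h
  · rw [Nat.sub_eq_zero_of_le h, Nat.sub_eq_zero_of_le h.le, min_eq_left h, min_eq_left h.le,
      pow_succ', Nat.add_sub_cancel, Matrix.add_mul, Matrix.mul_assoc]
    simp
  · rw [min_eq_right (by omega), min_eq_right (by omega), show j + 1 - H = j - H + 1 by omega,
      pow_succ']
    simp [Matrix.mul_assoc]

/-- Pure slack, with d = 1 - γ²: γ ≤ 1, 1 ≤ τ², k ≤ 2(bk² + k)/d and ν ≤ ν², while r ≥ 0 is simply
added. -/
lemma excess_bound_le {ν τ γ r b k q s e : ℝ} (hν : 1 ≤ ν) (hτ : 1 ≤ τ) (hγ0 : 0 ≤ γ)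
    (hγ1 : γ < 1) (hr : 0 ≤ r) (hb : 0 ≤ b) (hk : 0 ≤ k) (hq : 0 ≤ q) (hs : 0 ≤ s) (he : 0 ≤ e) :
    ν * e * (2 * τ ^ 2 * k * (s + b * (τ ^ 2 * γ * q / (1 - γ ^ 2)))) / (1 - γ ^ 2)
      ≤ ν ^ 2 * e * (r + 4 * τ ^ 4 * (b * k ^ 2 + k) * (b * q + s) / (1 - γ ^ 2) ^ 3) := by
  have hd0 : 0 < 1 - γ ^ 2 := by nlinarith
  have hd1 : 1 - γ ^ 2 ≤ 1 := by nlinarith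
  set d := 1 - γ ^ 2
  have hτ2 : 1 ≤ τ ^ 2 := one_le_pow₀ hτ
  have h1 : s + b * (τ ^ 2 * γ * q / d) ≤ τ ^ 2 * (b * q + s) / d := by
    rw [le_div_iff₀ hd0]
    have e1 : b * (τ ^ 2 * γ * q / d) * d = τ ^ 2 * (b * q) * γ := by field_simp
    have e2 : τ ^ 2 * (b * q) * γ ≤ τ ^ 2 * (b * q) := mul_le_of_le_one_right (by positivity) hγ1.le
    have e3 : s * d ≤ s := mul_le_of_le_one_right hs hd1
    have e4 : s ≤ τ ^ 2 * s := le_mul_of_one_le_left hs hτ2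
    linarith
  have h2 : k ≤ 2 * (b * k ^ 2 + k) / d := by
    rw [le_div_iff₀ hd0]
    have e1 : k * d ≤ k := mul_le_of_le_one_right hk hd1
    have e2 : 0 ≤ b * k ^ 2 := by positivity
    linarith
  calc ν * e * (2 * τ ^ 2 * k * (s + b * (τ ^ 2 * γ * q / d))) / d
      ≤ ν * e * (2 * τ ^ 2 * (2 * (b * k ^ 2 + k) / d) * (τ ^ 2 * (b * q + s) / d)) / d := by
        gcongr
    _ = ν * e * (4 * τ ^ 4 * (b * k ^ 2 + k) * (b * q + s) / d ^ 3) := by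
        field_simp; ring
    _ ≤ ν ^ 2 * e * (r + 4 * τ ^ 4 * (b * k ^ 2 + k) * (b * q + s) / d ^ 3) := by
        gcongr
        · nlinarith
        · linarith

end LQR

theorem mainTheorem3 {Ω : Type*} [MeasurableSpace Ω] (μ : Measure Ω) [IsProbabilityMeasure μ]
    {nx nu : ℕ}
    (A : Matrix (Fin nx) (Fin nx) ℝ) (B : Matrix (Fin nx) (Fin nu) ℝ)
    (Q : Matrix (Fin nx) (Fin nx) ℝ) (R : Matrix (Fin nu) (Fin nu) ℝ)
    (S : Matrix (Fin nu) (Fin nx) ℝ)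
    (hQRS : (Matrix.fromBlocks Q Sᵀ S R).PosSemidef)
    (x₀ : Fin nx → ℝ) (w : ℕ → Ω → (Fin nx → ℝ)) (hw : LQR.IsWhiteNoise μ w)
    (τ ρ : ℝ) (hρ : 0 < ρ)
    (hA : LQR.IsStable A τ (Real.exp (-ρ)))
    (K : Matrix (Fin nu) (Fin nx) ℝ)
    (hK : LQR.IsStable (A + B * K) τ (Real.exp (-ρ)))
    (H : ℕ) :
    ∃ cL cK : ℝ,
      LQR.HasDRCCost μ A B Q R S x₀ w H (LQR.equivalentDRC A B K) cL ∧
      LQR.HasFeedbackCost μ A B Q R S x₀ w K cK ∧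
      cL - cK ≤ (nx : ℝ) ^ 2 * Real.exp (-2 * ρ * H) *
        (‖R‖ + 4 * τ ^ 4 * (‖B‖ * ‖K‖ ^ 2 + ‖K‖) * (‖B‖ * ‖Q‖ + ‖S‖) /
          (1 - Real.exp (-2 * ρ)) ^ 3) := by
  have hexp : Real.exp (-2 * ρ) = Real.exp (-ρ) ^ 2 := by
    rw [← Real.exp_nat_mul]; congr 1; push_cast; ring
  have hexpH : Real.exp (-2 * ρ * H) = (Real.exp (-ρ) ^ 2) ^ H := by
    rw [← hexp, ← Real.exp_nat_mul]; congr 1; ring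
  rw [hexp, hexpH]
  have hγ0 : 0 ≤ Real.exp (-ρ) := (Real.exp_pos _).le
  have hγ1 : Real.exp (-ρ) < 1 := Real.exp_lt_one_iff.2 (by linarith)
  generalize Real.exp (-ρ) = γ at *
  obtain ⟨hQt, hQ0, hR0⟩ := LQR.trace_nonneg_of_posSemidef_fromBlocks (k := nx) hQRS
  have hτ := hA.nonneg
  have hKF : ∀ j, ‖K * (A + B * K) ^ j‖ ≤ ‖K‖ * τ * γ ^ j := fun j =>
    (Matrix.l2_opNorm_mul _ _).trans
      ((mul_le_mul_of_nonneg_left (hK j) (norm_nonneg _)).trans_eq (by ring))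
  set G : ℕ → Matrix (Fin nu) (Fin nx) ℝ :=
    fun j => if j < H then LQR.equivalentDRC A B K (j + 1) else 0 with hG
  have hGn : ∀ j, ‖G j‖ ≤ ‖K‖ * τ * γ ^ j := fun j => by
    simp only [hG, LQR.equivalentDRC, Nat.add_sub_cancel]
    split_ifs
    · exact hKF j
    · rw [norm_zero]; positivity
  have hFn : ∀ j, ‖LQR.truncatedGain A B K H j‖ ≤ τ ^ 2 * γ ^ j := fun j =>
    calc ‖LQR.truncatedGain A B K H j‖ ≤ ‖A ^ (j - H)‖ * ‖(A + B * K) ^ min j H‖ :=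
          norm_mul_le _ _
      _ ≤ τ * γ ^ (j - H) * (τ * γ ^ min j H) := by gcongr; exacts [hA _, hK _]
      _ = τ ^ 2 * γ ^ (j - H + min j H) := by ring
      _ = τ ^ 2 * γ ^ j := by congr 2; omega
  obtain ⟨cL, hL⟩ := LQR.summable_gainCost Q R S hγ0 hγ1 hFn hGn
  obtain ⟨cK, hKs⟩ := LQR.summable_gainCost Q R S hγ0 hγ1 hK hKF
  refine ⟨cL, cK, ?_, ?_, ?_⟩
  · have h := hw.hasAverageCost_response Q R S (hA.tendsto_pow_mulVec hγ0 hγ1 x₀)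
      (tendsto_const_nhds (x := (0 : Fin nu → ℝ))) hL
    unfold LQR.HasDRCCost
    simp only [LQR.drcInput_eq_response]
    simp only [← LQR.state_eq_response A B x₀ _ (F := LQR.truncatedGain A B K H) (G := G)
      (by simp [LQR.truncatedGain]) (LQR.truncatedGain_succ A B K H)] at h
    exact h
  · have hx := hK.tendsto_pow_mulVec hγ0 hγ1 x₀
    have hcont : Continuous fun x : Fin nx → ℝ => K *ᵥ x := by fun_prop
    have hu : Tendsto (fun t => K *ᵥ ((A + B * K) ^ t *ᵥ x₀)) atTop (𝓝 0) := by
      simpa [Function.comp_def] using (hcont.tendsto 0).comp hx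
    unfold LQR.HasFeedbackCost
    simp only [LQR.feedbackState_eq_response, LQR.mulVec_response]
    exact hw.hasAverageCost_response Q R S hx hu hKs
  · have h₁ := (hasSum_nat_add_iff' H).2 hL
    have h₂ := (hasSum_nat_add_iff' H).2 hKs
    have hhead : ∑ j ∈ Finset.range H, LQR.gainCost Q R S (LQR.truncatedGain A B K H j) (G j)
        = ∑ j ∈ Finset.range H,
          LQR.gainCost Q R S ((A + B * K) ^ j) (K * (A + B * K) ^ j) :=
      Finset.sum_congr rfl fun j hj => by
        have hj := Finset.mem_range.1 hj
        simp [LQR.truncatedGain, hG, hj, hj.le, LQR.equivalentDRC]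
    have h₁' : HasSum (fun k => LQR.gainCost Q R S (A ^ k * (A + B * K) ^ H) 0) _ :=
      h₁.congr_fun fun k => by simp [LQR.truncatedGain, hG]
    have hmain := LQR.gainCost_tail_sub_le hγ0 hγ1 hA hK hQt hQ0 hR0 H h₁' h₂
    rw [hhead, sub_sub_sub_cancel_right] at hmain
    refine hmain.trans ?_
    -- In dimension zero ‖1‖ = 0, so τ ≥ 1 is not available, but both sides vanish.
    rcases Nat.eq_zero_or_pos nx with h0 | hpos
    · subst h0; simp
    · have : NeZero nx := ⟨hpos.ne'⟩
      have hτ1 : 1 ≤ τ := by simpa using hA 0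
      exact LQR.excess_bound_le (by exact_mod_cast hpos) hτ1 hγ0 hγ1 (norm_nonneg _)
        (norm_nonneg _) (norm_nonneg _) (norm_nonneg _) (norm_nonneg _) (by positivity)
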